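/- Let $X$ be an AM-space, i.e. a real Banach lattice with $\|x\vee y\|=\max\{\|x\|,\|y\|\}$ whenever $x\wedge y=0$. An *AM-algebra product with approximate unit* on $X$ is an associative bilinear map $P\colon X\times X\to X$ with $P(x,y)\ge 0$ for all $x,y\ge 0$ and $\|P(x,y)\|\le\|x\|\,\|y\|$ for all $x,y\in X$, for which there is a net $(e_\alpha)$ of positive elements of $X$ such that $x^*(e_\alpha)\to\|x^*\|$ for every positive $x^*\in X^*$, and $P(e_\alpha,a)\to a$ and $P(a,e_\alpha)\to a$ in norm for every $a\in X$. If there exists an AM-algebra product with approximate unit on $X$, then it is unique (irrespective of the net). Moreover, let $K_X$ be the set of all lattice homomorphisms $x^*\colon X\to\mathbb R$ in the closed unit ball of $X^*$, with the weak$^*$ topology, and identify each $x\in X$ with the positively homogeneous continuous function $x^*\mapsto x^*(x)$ on $K_X$. Then this product $P$ is given by $$P(f,g)(x^*)=\frac{f(x^*)\,g(x^*)}{\|x^*\|}\qquad\text{for all } f,g\in X \text{ and } x^*\in K_X\setminus\{0\},$$ that is, $x^*(P(f,g))=x^*(f)\,x^*(g)/\|x^*\|$. -/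

import Mathlib

open Filter Topology

universe u v w

/-- A Banach lattice (given by the type-class assumptions) is an AM-space if
`‖x ⊔ y‖ = max ‖x‖ ‖y‖` for all disjoint `x, y`, that is, whenever `x ⊓ y = 0`. -/
def IsAMSpace (X : Type*) [NormedAddCommGroup X] [Lattice X] : Prop :=
  ∀ x y : X, x ⊓ y = 0 → ‖x ⊔ y‖ = max ‖x‖ ‖y‖

section Products

variable {X : Type*} [NormedAddCommGroup X] [NormedSpace ℝ X] [Lattice X]

/-- The bilinear map `P` is a product making the Banach lattice `X` a Banach lattice algebra:
it is associative, products of positive elements are positive, and the norm is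
submultiplicative. No commutativity and no algebraic identity are required. -/
structure IsBanachLatticeAlgebraProduct (P : X →ₗ[ℝ] X →ₗ[ℝ] X) : Prop where
  assoc : ∀ x y z : X, P (P x y) z = P x (P y z)
  nonneg : ∀ x y : X, 0 ≤ x → 0 ≤ y → 0 ≤ P x y
  norm_le : ∀ x y : X, ‖P x y‖ ≤ ‖x‖ * ‖y‖

/-- The net `e` of positive elements is an approximate order unit of `X`:
`φ (e α) → ‖φ‖` for every positive functional `φ` in the norm dual of `X`. -/
def IsApproxOrderUnit {ι : Type*} [Preorder ι] (e : ι → X) : Prop :=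
  (∀ α, 0 ≤ e α) ∧
    ∀ φ : StrongDual ℝ X, (∀ x : X, 0 ≤ x → 0 ≤ φ x) →
      Tendsto (fun α => φ (e α)) atTop (𝓝 ‖φ‖)

/-- The net `e` is an approximate (two-sided) algebraic identity for the product `P`. -/
def IsApproxIdentity (P : X →ₗ[ℝ] X →ₗ[ℝ] X) {ι : Type*} [Preorder ι] (e : ι → X) : Prop :=
  ∀ a : X, Tendsto (fun α => P (e α) a) atTop (𝓝 a) ∧
    Tendsto (fun α => P a (e α)) atTop (𝓝 a)

end Products

/-- The product `P` makes `X` an AM-algebra with approximate unit: `X` with `P` is a Banach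
lattice algebra, and some net (indexed by a nonempty directed preorder in the universe `w`) is
both an approximate order unit and an approximate algebraic identity. -/
def IsAMAlgebraProduct {X : Type u} [NormedAddCommGroup X] [NormedSpace ℝ X] [Lattice X]
    (P : X →ₗ[ℝ] X →ₗ[ℝ] X) : Prop :=
  IsBanachLatticeAlgebraProduct P ∧
    ∃ (ι : Type w) (_ : Preorder ι) (_ : Nonempty ι) (_ : IsDirected ι (· ≤ ·)) (e : ι → X),
      IsApproxOrderUnit e ∧ IsApproxIdentity P e

section Representation

variable (X : Type*) [NormedAddCommGroup X] [NormedSpace ℝ X] [Lattice X]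

/-- `K_X`: the functionals in the closed unit ball of the dual that are lattice homomorphisms
(a linear map preserving `⊔` also preserves `⊓`), with the weak-* topology. -/
def KX : Set (WeakDual ℝ X) :=
  {φ | (∀ x y : X, φ (x ⊔ y) = φ x ⊔ φ y) ∧ ‖WeakDual.toStrongDual φ‖ ≤ 1}

/-- `C_ph(K_X)`: the positively homogeneous continuous functions on `K_X`. -/
def Cph : Submodule ℝ C(KX X, ℝ) where
  carrier := {f | ∀ (φ ψ : KX X) (r : ℝ), 0 ≤ r →
    (ψ : WeakDual ℝ X) = r • (φ : WeakDual ℝ X) → f ψ = r * f φ}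
  add_mem' := by
    intro f g hf hg φ ψ r hr h
    simp only [ContinuousMap.add_apply, hf φ ψ r hr h, hg φ ψ r hr h, mul_add]
  zero_mem' := by
    intro φ ψ r _ _
    simp
  smul_mem' := by
    intro c f hf φ ψ r hr h
    simp only [ContinuousMap.smul_apply, hf φ ψ r hr h, smul_eq_mul, mul_left_comm]

variable {X}

/-- The identification `x ↦ ev_x` of `X` with `C_ph(K_X)`, where `ev_x (φ) = φ x`. -/
noncomputable def ev (x : X) : Cph X :=
  ⟨⟨fun φ => (φ : WeakDual ℝ X) x, (WeakDual.eval_continuous x).comp continuous_subtype_val⟩, by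
    intro φ ψ r _ h
    change (ψ : WeakDual ℝ X) x = r * (φ : WeakDual ℝ X) x
    rw [h]
    rfl⟩

end Representation

/-! Let `φ ≠ 0` be a lattice homomorphism. For `0 ≤ x` the functional `y ↦ φ (P x y)` is positive,
so its norm is `lim φ (P x (e α)) = φ x`. Hence `φ x = 0` forces `φ (P x y) = 0`; splitting into
positive and negative parts, and flipping `P`, makes `ker φ` a two-sided ideal. So `φ (P x y) = k *
(φ x * φ y)`, and inserting `e α` gives `k * ‖φ‖ = 1`.

Uniqueness then needs `KX X` to separate points. The approximate order unit makes the dual norm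
additive on positive functionals, so extreme points of the positive dual ball are lattice
homomorphisms. Krein–Milman transfers separation from this ball, where it holds by Hahn–Banach, to
`KX X`. -/

section PositiveFunctionals

/-! ### Positive functionals via Hahn–Banach -/

variable {X : Type*} [NormedAddCommGroup X] [NormedSpace ℝ X] [Lattice X] [IsOrderedAddMonoid X]

omit [Lattice X] [IsOrderedAddMonoid X] in
/-- A nonnegative sublinear functional is attained at any prescribed `x` by a linear functional
it dominates. -/
theorem exists_linearMap_le_sublinear_eq (p : X → ℝ)
    (hp_smul : ∀ c : ℝ, 0 < c → ∀ x, p (c • x) = c * p x)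
    (hp_add : ∀ x y, p (x + y) ≤ p x + p y) (hp_nonneg : ∀ x, 0 ≤ p x) (x : X) :
    ∃ g : X →ₗ[ℝ] ℝ, (∀ y, g y ≤ p y) ∧ g x = p x := by
  have hp0 : p 0 = 0 := by
    have h := hp_smul 2 two_pos 0
    rw [smul_zero] at h
    linarith
  by_cases hx : x = 0
  · exact ⟨0, fun y => hp_nonneg y, by simp [hx, hp0]⟩
  obtain ⟨g, hg, hgp⟩ := exists_extension_of_le_sublinear
    (LinearPMap.mkSpanSingleton x (p x) hx) p hp_smul hp_add (by
      rintro ⟨y, hy⟩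
      obtain ⟨c, rfl⟩ := Submodule.mem_span_singleton.1 hy
      rw [show LinearPMap.mkSpanSingleton x (p x) hx ⟨c • x, hy⟩ = c * p x from
        LinearPMap.mkSpanSingleton'_apply x (p x) _ c hy]
      rcases lt_trichotomy c 0 with hc | rfl | hc
      · exact (mul_nonpos_of_nonpos_of_nonneg hc.le (hp_nonneg x)).trans (hp_nonneg _)
      · simp [hp0]
      · exact (hp_smul c hc x).ge)
  refine ⟨g, hgp, ?_⟩
  exact (hg ⟨x, Submodule.mem_span_singleton_self x⟩).trans
    (LinearPMap.mkSpanSingleton_apply ℝ ℝ hx (p x))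

omit [NormedSpace ℝ X] in
theorem posPart_add_le (x y : X) : (x + y)⁺ ≤ x⁺ + y⁺ :=
  sup_le (add_le_add (le_posPart x) (le_posPart y)) (add_nonneg (posPart_nonneg x) (posPart_nonneg y))

omit [IsOrderedAddMonoid X] in
theorem posPart_pos_smul [IsOrderedModule ℝ X] {c : ℝ} (hc : 0 < c) (x : X) :
    (c • x)⁺ = c • x⁺ := by
  apply le_antisymm
  · exact sup_le (smul_le_smul_of_nonneg_left (le_posPart x) hc.le)
      (smul_nonneg hc.le (posPart_nonneg x))
  · rw [← le_inv_smul_iff_of_pos hc]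
    refine sup_le ?_ (smul_nonneg (inv_nonneg.2 hc.le) (posPart_nonneg _))
    rw [le_inv_smul_iff_of_pos hc]
    exact le_posPart _

omit [NormedSpace ℝ X] in
theorem norm_posPart_le [HasSolidNorm X] (x : X) : ‖x⁺‖ ≤ ‖x‖ := by
  apply norm_le_norm_of_abs_le_abs
  rw [abs_of_nonneg (posPart_nonneg x)]
  exact sup_le (le_abs_self x) (abs_nonneg x)

theorem map_le_map_of_nonneg {φ : X →ₗ[ℝ] ℝ} (hφ : ∀ x, 0 ≤ x → 0 ≤ φ x) {x y : X}
    (h : x ≤ y) : φ x ≤ φ y := by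
  have := hφ (y - x) (sub_nonneg.2 h)
  rw [map_sub] at this
  linarith

/-- For positive `φ` and any `x` there is a functional `g` with `0 ≤ g ≤ φ` and `g x = φ x⁺`. -/
theorem exists_nonneg_le_apply_eq_posPart [IsOrderedModule ℝ X] {φ : X →ₗ[ℝ] ℝ}
    (hφ : ∀ x, 0 ≤ x → 0 ≤ φ x) (x : X) :
    ∃ g : X →ₗ[ℝ] ℝ, (∀ y, 0 ≤ y → 0 ≤ g y) ∧ (∀ y, 0 ≤ y → g y ≤ φ y) ∧ g x = φ x⁺ := by
  obtain ⟨g, hg, hgx⟩ := exists_linearMap_le_sublinear_eq (fun y => φ y⁺)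
    (fun c hc y => by simp [posPart_pos_smul hc])
    (fun y z => by
      rw [← map_add]
      exact map_le_map_of_nonneg hφ (posPart_add_le y z))
    (fun y => hφ _ (posPart_nonneg y)) x
  refine ⟨g, fun y hy => ?_, fun y hy => ?_, hgx⟩
  · have h := hg (-y)
    simp only [posPart_eq_zero.2 (neg_nonpos.2 hy), map_neg, map_zero] at h
    linarith
  · simpa only [posPart_of_nonneg hy] using hg y

/-- A positive functional that spans an extreme ray of the positive cone is a lattice
homomorphism. -/
theorem map_sup_of_forall_le_eq_smul [IsOrderedModule ℝ X] {φ : X →ₗ[ℝ] ℝ}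
    (hφ : ∀ x, 0 ≤ x → 0 ≤ φ x)
    (hext : ∀ g : X →ₗ[ℝ] ℝ, (∀ y, 0 ≤ y → 0 ≤ g y) → (∀ y, 0 ≤ y → g y ≤ φ y) →
      ∃ c : ℝ, g = c • φ) (x y : X) : φ (x ⊔ y) = φ x ⊔ φ y := by
  have key : ∀ z : X, φ z⁺ = φ z ⊔ 0 := by
    intro z
    obtain ⟨g, hg0, hgφ, hgz⟩ := exists_nonneg_le_apply_eq_posPart hφ z
    obtain ⟨c, rfl⟩ := hext g hg0 hgφ
    have hp := hφ _ (posPart_nonneg z)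
    have hn := hφ _ (negPart_nonneg z)
    have hz : φ z = φ z⁺ - φ z⁻ := by rw [← map_sub, posPart_sub_negPart]
    have h1 := hgφ _ (posPart_nonneg z)
    have h2 := hg0 _ (negPart_nonneg z)
    simp only [LinearMap.smul_apply, smul_eq_mul, hz, mul_sub] at hgz h1 h2
    -- `c * φ z⁻ = c * φ z⁺ - φ z⁺` is at most zero because `g ≤ φ` at `z⁺`, and nonnegative because
    -- `0 ≤ g` at `z⁻`.
    have h3 : c * φ z⁻ = 0 := by linarith
    rcases mul_eq_zero.1 h3 with rfl | h4
    · rw [sup_eq_right.2] <;> linarith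
    · rw [sup_eq_left.2] <;> linarith
  have h : x ⊔ y = (x - y)⁺ + y := by
    rw [posPart_def, sup_add, sub_add_cancel, zero_add]
  rw [h, map_add, key, map_sub, sup_add, sub_add_cancel, zero_add]

/-- The positive part of the dual unit ball separates points. -/
theorem exists_nonneg_norm_le_one_apply_ne_zero [IsOrderedModule ℝ X] [HasSolidNorm X]
    {z : X} (hz : z ≠ 0) :
    ∃ φ : StrongDual ℝ X, (∀ x, 0 ≤ x → 0 ≤ φ x) ∧ ‖φ‖ ≤ 1 ∧ φ z ≠ 0 := by
  have key : ∀ x : X, x⁺ ≠ 0 →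
      ∃ φ : StrongDual ℝ X, (∀ x, 0 ≤ x → 0 ≤ φ x) ∧ ‖φ‖ ≤ 1 ∧ φ x ≠ 0 := by
    intro x hx
    -- Domination by `‖y⁺‖` yields both positivity (it vanishes for `y ≤ 0`) and norm at most one.
    obtain ⟨g, hg, hgx⟩ := exists_linearMap_le_sublinear_eq (fun y : X => ‖y⁺‖)
      (fun c hc y => by simp [posPart_pos_smul hc, norm_smul, abs_of_pos hc])
      (fun y z => by
        refine le_trans (norm_le_norm_of_abs_le_abs ?_) (norm_add_le _ _)
        rw [abs_of_nonneg (posPart_nonneg _),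
          abs_of_nonneg (add_nonneg (posPart_nonneg _) (posPart_nonneg _))]
        exact posPart_add_le y z)
      (fun y => norm_nonneg _) x
    have hbound : ∀ y, ‖g y‖ ≤ 1 * ‖y‖ := by
      intro y
      have h1 := (hg y).trans (norm_posPart_le y)
      have h2 := (hg (-y)).trans (norm_posPart_le (-y))
      rw [map_neg, norm_neg] at h2
      rw [one_mul, Real.norm_eq_abs, abs_le]
      constructor <;> linarith
    refine ⟨g.mkContinuous 1 hbound, fun y hy => ?_, g.mkContinuous_norm_le zero_le_one _, ?_⟩
    · have h := hg (-y)
      simp only [posPart_eq_zero.2 (neg_nonpos.2 hy), map_neg, norm_zero] at h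
      rw [LinearMap.mkContinuous_apply]
      linarith
    · rw [LinearMap.mkContinuous_apply, hgx]
      exact norm_ne_zero_iff.2 hx
  by_cases h : z⁺ = 0
  · have h' : (-z)⁺ ≠ 0 := by
      rw [posPart_neg]
      intro h'
      apply hz
      rw [← posPart_sub_negPart z, h, h', sub_zero]
    obtain ⟨φ, h1, h2, h3⟩ := key _ h'
    exact ⟨φ, h1, h2, fun h => h3 (by rw [map_neg, h, neg_zero])⟩
  · exact key _ h

end PositiveFunctionals

/-! ### Krein–Milman in the positive dual ball -/

section KreinMilman

variable {X : Type*} [NormedAddCommGroup X] [NormedSpace ℝ X] [Lattice X]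

/-- On positive functionals the norm is a limit of evaluations at `e α`, hence additive. -/
theorem IsApproxOrderUnit.norm_add {ι : Type*} [Preorder ι] [Nonempty ι]
    [IsDirected ι (· ≤ ·)] {e : ι → X} (he : IsApproxOrderUnit e) {φ ψ : StrongDual ℝ X}
    (hφ : ∀ x : X, 0 ≤ x → 0 ≤ φ x) (hψ : ∀ x : X, 0 ≤ x → 0 ≤ ψ x) :
    ‖φ + ψ‖ = ‖φ‖ + ‖ψ‖ :=
  tendsto_nhds_unique (he.2 (φ + ψ) fun x hx => add_nonneg (hφ x hx) (hψ x hx))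
    ((he.2 φ hφ).add (he.2 ψ hψ))

variable (X) in
/-- The positive functionals in the closed unit ball of the dual. -/
def positiveDualBall : Set (WeakDual ℝ X) :=
  {φ | (∀ x : X, 0 ≤ x → 0 ≤ φ x) ∧ ‖WeakDual.toStrongDual φ‖ ≤ 1}

theorem isCompact_positiveDualBall : IsCompact (positiveDualBall X) := by
  have h : positiveDualBall X = (⋂ x : X, ⋂ _ : 0 ≤ x, {φ : WeakDual ℝ X | 0 ≤ φ x}) ∩
      WeakDual.toStrongDual ⁻¹' Metric.closedBall 0 1 := by
    ext φ
    simp [positiveDualBall]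
  rw [h]
  exact (WeakDual.isCompact_closedBall (𝕜 := ℝ) (E := X) 0 1).inter_left
    (isClosed_iInter fun x => isClosed_iInter fun _ =>
      isClosed_le continuous_const (WeakDual.eval_continuous x))

theorem convex_positiveDualBall : Convex ℝ (positiveDualBall X) := by
  intro φ hφ ψ hψ a b ha hb hab
  refine ⟨fun x hx => ?_, ?_⟩
  · exact add_nonneg (mul_nonneg ha (hφ.1 x hx)) (mul_nonneg hb (hψ.1 x hx))
  · have h := convex_closedBall (0 : StrongDual ℝ X) 1
      (mem_closedBall_zero_iff.2 hφ.2) (mem_closedBall_zero_iff.2 hψ.2) ha hb hab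
    exact mem_closedBall_zero_iff.1 h

variable [IsOrderedAddMonoid X] [IsOrderedModule ℝ X] [HasSolidNorm X]

omit [IsOrderedModule ℝ X] [HasSolidNorm X] in
theorem abs_apply_le_of_nonneg {g : X →ₗ[ℝ] ℝ} (hg : ∀ y, 0 ≤ y → 0 ≤ g y) (y : X) :
    |g y| ≤ g |y| := by
  have h1 := map_le_map_of_nonneg hg (le_abs_self y)
  have h2 := map_le_map_of_nonneg hg (neg_le.1 (neg_le_abs y))
  rw [map_neg] at h2
  exact abs_le.2 ⟨h2, h1⟩

/-- Extreme points of the positive dual ball are lattice homomorphisms as soon as the dual norm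
is additive on positive functionals. -/
theorem extremePoints_positiveDualBall_subset
    (hadd : ∀ φ ψ : StrongDual ℝ X, (∀ x : X, 0 ≤ x → 0 ≤ φ x) → (∀ x : X, 0 ≤ x → 0 ≤ ψ x) →
      ‖φ + ψ‖ = ‖φ‖ + ‖ψ‖) :
    (positiveDualBall X).extremePoints ℝ ⊆ KX X := by
  intro φ hφ
  obtain ⟨⟨hpos, hnorm⟩, hext⟩ := mem_extremePoints.1 hφ
  refine ⟨map_sup_of_forall_le_eq_smul (φ := (WeakDual.toStrongDual φ).toLinearMap) hpos ?_, hnorm⟩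
  intro g hg0 hgφ
  have hbound : ∀ y, ‖g y‖ ≤ ‖WeakDual.toStrongDual φ‖ * ‖y‖ := by
    intro y
    rw [Real.norm_eq_abs]
    refine (abs_apply_le_of_nonneg hg0 y).trans ((hgφ _ (abs_nonneg y)).trans ?_)
    have h := (WeakDual.toStrongDual φ).le_opNorm |y|
    rw [norm_abs_eq_norm] at h
    exact (le_abs_self _).trans h
  set G : StrongDual ℝ X := g.mkContinuous _ hbound with hG
  set H : StrongDual ℝ X := WeakDual.toStrongDual φ - G with hH
  have hGpos : ∀ x : X, 0 ≤ x → 0 ≤ G x := hg0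
  have hHpos : ∀ x : X, 0 ≤ x → 0 ≤ H x := fun x hx => sub_nonneg.2 (hgφ x hx)
  have hsum : G + H = WeakDual.toStrongDual φ := by rw [hH]; abel
  have hGH := hadd G H hGpos hHpos
  rw [hsum] at hGH
  have hgG : ∀ c : ℝ, G = c • WeakDual.toStrongDual φ →
      ∃ c : ℝ, g = c • (WeakDual.toStrongDual φ).toLinearMap := fun c h =>
    ⟨c, LinearMap.ext fun x => congrArg (fun F : StrongDual ℝ X => F x) h⟩
  by_cases hG0 : G = 0
  · exact hgG 0 (by rw [hG0, zero_smul])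
  by_cases hH0 : H = 0
  · exact hgG 1 (by rw [one_smul, ← hsum, hH0, add_zero])
  have hGn : 0 < ‖G‖ := norm_pos_iff.2 hG0
  have hHn : 0 < ‖H‖ := norm_pos_iff.2 hH0
  have mem : ∀ F : StrongDual ℝ X, F ≠ 0 → (∀ x : X, 0 ≤ x → 0 ≤ F x) →
      StrongDual.toWeakDual (‖F‖⁻¹ • F) ∈ positiveDualBall X := by
    intro F hF hFpos
    refine ⟨fun x hx => mul_nonneg (inv_nonneg.2 (norm_nonneg F)) (hFpos x hx), ?_⟩
    change ‖‖F‖⁻¹ • F‖ ≤ 1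
    rw [norm_smul, norm_inv, norm_norm, inv_mul_cancel₀ (norm_ne_zero_iff.2 hF)]
  have hφn : 0 < ‖WeakDual.toStrongDual φ‖ := by linarith
  -- `φ` lies on the open segment between `0` and its normalization, so it has norm one
  have hone : ‖WeakDual.toStrongDual φ‖ = 1 := by
    by_contra hne
    have hlt : ‖WeakDual.toStrongDual φ‖ < 1 := lt_of_le_of_ne hnorm hne
    have hzero : (0 : WeakDual ℝ X) ∈ positiveDualBall X :=
      ⟨fun x _ => le_rfl, by rw [map_zero, norm_zero]; exact zero_le_one⟩
    have h := (hext _ hzero _ (mem _ (norm_pos_iff.1 hφn) hpos)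
      ⟨1 - ‖WeakDual.toStrongDual φ‖, ‖WeakDual.toStrongDual φ‖, by linarith, hφn, by ring, by
        change (1 - ‖WeakDual.toStrongDual φ‖) • (0 : StrongDual ℝ X) +
          ‖WeakDual.toStrongDual φ‖ • ‖WeakDual.toStrongDual φ‖⁻¹ • WeakDual.toStrongDual φ =
            WeakDual.toStrongDual φ
        rw [smul_zero, zero_add, smul_inv_smul₀ hφn.ne']⟩).1
    rw [← h, map_zero, norm_zero] at hφn
    exact hφn.false
  -- The weights `‖G‖` and `‖H‖` sum to `‖φ‖ = 1` by additivity of the norm, so extremality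
  -- identifies `φ` with the normalized `G`.
  have h := (hext _ (mem G hG0 hGpos) _ (mem H hH0 hHpos)
    ⟨‖G‖, ‖H‖, hGn, hHn, by linarith, by
      change ‖G‖ • ‖G‖⁻¹ • G + ‖H‖ • ‖H‖⁻¹ • H = WeakDual.toStrongDual φ
      rw [smul_inv_smul₀ hGn.ne', smul_inv_smul₀ hHn.ne', hsum]⟩).1
  refine hgG ‖G‖ ?_
  have h' : ‖G‖⁻¹ • G = WeakDual.toStrongDual φ := h
  rw [← h', smul_inv_smul₀ hGn.ne']

/-- If evaluation at `z` vanished on `KX X`, it would vanish on the closed convex hull of the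
extreme points, which is the whole positive dual ball. -/
theorem exists_mem_KX_apply_ne_zero
    (hadd : ∀ φ ψ : StrongDual ℝ X, (∀ x : X, 0 ≤ x → 0 ≤ φ x) → (∀ x : X, 0 ≤ x → 0 ≤ ψ x) →
      ‖φ + ψ‖ = ‖φ‖ + ‖ψ‖) {z : X} (hz : z ≠ 0) : ∃ φ ∈ KX X, φ z ≠ 0 := by
  have : LocallyConvexSpace ℝ (WeakDual ℝ X) :=
    inferInstanceAs (LocallyConvexSpace ℝ (WeakBilin (topDualPairing ℝ X)))
  by_contra! hcon
  obtain ⟨φ, hpos, hnorm, hφz⟩ := exists_nonneg_norm_le_one_apply_ne_zero hz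
  have hmem : StrongDual.toWeakDual φ ∈ positiveDualBall X := ⟨hpos, hnorm⟩
  rw [← closure_convexHull_extremePoints isCompact_positiveDualBall convex_positiveDualBall]
    at hmem
  have hclosed : IsClosed {ψ : WeakDual ℝ X | ψ z = 0} :=
    isClosed_eq (WeakDual.eval_continuous z) continuous_const
  have hconvex : Convex ℝ {ψ : WeakDual ℝ X | ψ z = 0} := by
    intro ψ hψ χ hχ a b _ _ _
    change a * ψ z + b * χ z = 0
    rw [show ψ z = 0 from hψ, show χ z = 0 from hχ, mul_zero, mul_zero, add_zero]
  exact hφz (closure_minimal (convexHull_min (fun ψ hψ =>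
    hcon ψ (extremePoints_positiveDualBall_subset hadd hψ)) hconvex) hclosed hmem)

end KreinMilman

/-! ### Lattice homomorphisms applied to a product -/

section ProductFormula

variable {X : Type*} [NormedAddCommGroup X] [NormedSpace ℝ X] [Lattice X]

/-- The norm of `y ↦ φ (P x y)` is computed along `e` by the order unit property, and the same limit
is `φ x` by the identity property. -/
theorem apply_product_le_of_approxIdentity {P : X →ₗ[ℝ] X →ₗ[ℝ] X}
    (hpos : ∀ x y : X, 0 ≤ x → 0 ≤ y → 0 ≤ P x y) (hnorm : ∀ x y : X, ‖P x y‖ ≤ ‖x‖ * ‖y‖)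
    {ι : Type*} [Preorder ι] [Nonempty ι] [IsDirected ι (· ≤ ·)] {e : ι → X}
    (he : IsApproxOrderUnit e) (hP : ∀ a, Tendsto (fun α => P a (e α)) atTop (𝓝 a))
    {φ : StrongDual ℝ X} (hφ : ∀ x : X, 0 ≤ x → 0 ≤ φ x) {x : X} (hx : 0 ≤ x) (y : X) :
    φ (P x y) ≤ φ x * ‖y‖ := by
  set ψ : StrongDual ℝ X := φ.comp ((P x).mkContinuous ‖x‖ (hnorm x)) with hψ
  have hψn : ‖ψ‖ = φ x :=
    tendsto_nhds_unique (he.2 ψ fun y hy => hφ _ (hpos x y hx hy))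
      ((φ.continuous.tendsto x).comp (hP x))
  rw [← hψn]
  exact (le_abs_self _).trans (ψ.le_opNorm y)

variable [IsOrderedAddMonoid X]

omit [IsOrderedAddMonoid X] in
theorem apply_nonneg_of_map_sup {φ : StrongDual ℝ X} (hφ : ∀ x y : X, φ (x ⊔ y) = φ x ⊔ φ y)
    (x : X) (hx : 0 ≤ x) : 0 ≤ φ x := by
  have h := hφ x 0
  rw [sup_eq_left.2 hx, map_zero] at h
  exact h ▸ le_sup_right

/-- For positive `x` the preceding bound at `y` and `-y` suffices; in general `x⁺` and `x⁻` again
lie in `ker φ`. -/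
theorem apply_product_eq_zero_of_apply_eq_zero {P : X →ₗ[ℝ] X →ₗ[ℝ] X}
    (hpos : ∀ x y : X, 0 ≤ x → 0 ≤ y → 0 ≤ P x y) (hnorm : ∀ x y : X, ‖P x y‖ ≤ ‖x‖ * ‖y‖)
    {ι : Type*} [Preorder ι] [Nonempty ι] [IsDirected ι (· ≤ ·)] {e : ι → X}
    (he : IsApproxOrderUnit e) (hP : ∀ a, Tendsto (fun α => P a (e α)) atTop (𝓝 a))
    {φ : StrongDual ℝ X} (hφ : ∀ x y : X, φ (x ⊔ y) = φ x ⊔ φ y) {x : X} (hx : φ x = 0) (y : X) :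
    φ (P x y) = 0 := by
  have hφ0 := apply_nonneg_of_map_sup hφ
  have key : ∀ u : X, 0 ≤ u → φ u = 0 → φ (P u y) = 0 := by
    intro u hu hu0
    have h1 := apply_product_le_of_approxIdentity hpos hnorm he hP hφ0 hu y
    have h2 := apply_product_le_of_approxIdentity hpos hnorm he hP hφ0 hu (-y)
    rw [map_neg, map_neg] at h2
    rw [hu0, zero_mul] at h1 h2
    linarith
  have hp : φ x⁺ = 0 := by rw [posPart_def, hφ, hx, map_zero, sup_idem]
  have hn : φ x⁻ = 0 := by rw [negPart_def, hφ, map_neg, hx, map_zero, neg_zero, sup_idem]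
  rw [← posPart_sub_negPart x, map_sub, LinearMap.sub_apply, map_sub,
    key _ (posPart_nonneg x) hp, key _ (negPart_nonneg x) hn, sub_zero]

/-- A lattice homomorphism `φ ≠ 0` turns an AM-algebra product into the pointwise product,
rescaled by `‖φ‖`. -/
theorem IsAMAlgebraProduct.apply_eq {X : Type u} [NormedAddCommGroup X] [NormedSpace ℝ X]
    [Lattice X] [IsOrderedAddMonoid X] {P : X →ₗ[ℝ] X →ₗ[ℝ] X} (hP : IsAMAlgebraProduct.{u, v} P)
    {φ : StrongDual ℝ X} (hφ : ∀ x y : X, φ (x ⊔ y) = φ x ⊔ φ y) (hφ0 : φ ≠ 0) (x y : X) :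
    φ (P x y) = φ x * φ y / ‖φ‖ := by
  obtain ⟨hBLA, ι, _, _, _, e, he, hid⟩ := hP
  have hl : ∀ {x : X} (y : X), φ x = 0 → φ (P x y) = 0 := fun y hx =>
    apply_product_eq_zero_of_apply_eq_zero hBLA.nonneg hBLA.norm_le he (fun a => (hid a).2) hφ hx y
  have hr : ∀ (x : X) {y : X}, φ y = 0 → φ (P x y) = 0 := fun x y hy =>
    apply_product_eq_zero_of_apply_eq_zero (P := P.flip)
      (fun u v hu hv => hBLA.nonneg v u hv hu)
      (fun u v => (hBLA.norm_le v u).trans_eq (mul_comm _ _)) he (fun a => (hid a).1) hφ hy x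
  obtain ⟨w, hw⟩ : ∃ w, φ w = 1 := by
    obtain ⟨u, hu⟩ : ∃ u, φ u ≠ 0 := by
      by_contra! h
      exact hφ0 (ContinuousLinearMap.ext h)
    exact ⟨(φ u)⁻¹ • u, by rw [map_smul, smul_eq_mul, inv_mul_cancel₀ hu]⟩
  -- Modulo `ker φ`, `x` and `y` are `φ x • w` and `φ y • w`.
  have hmul : ∀ x y, φ (P x y) = φ (P w w) * (φ x * φ y) := by
    intro x y
    have h1 := hl (x := x - φ x • w) y (by simp [hw])
    have h2 := hr w (y := y - φ y • w) (by simp [hw])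
    simp only [map_sub, map_smul, LinearMap.sub_apply, LinearMap.smul_apply, smul_eq_mul]
      at h1 h2
    linear_combination h1 + φ x * h2
  -- Two limits of `φ (P w (e α))`: the identity property gives `φ w = 1`, the order unit property
  -- the left side.
  have hk : φ (P w w) * ‖φ‖ = 1 := by
    have h1 : Tendsto (fun α => φ (P w (e α))) atTop (𝓝 (φ w)) :=
      (φ.continuous.tendsto w).comp (hid w).2
    rw [hw, show (fun α => φ (P w (e α))) = fun α => φ (P w w) * φ (e α) from
      funext fun α => by rw [hmul, hw, one_mul]] at h1
    exact tendsto_nhds_unique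
      ((he.2 φ (apply_nonneg_of_map_sup hφ)).const_mul (φ (P w w))) h1
  rw [hmul, eq_div_iff (norm_ne_zero_iff.2 hφ0)]
  linear_combination (φ x * φ y) * hk

end ProductFormula

theorem proposition3p4 {X : Type u} [NormedAddCommGroup X] [NormedSpace ℝ X]
    [CompleteSpace X] [Lattice X] [IsOrderedAddMonoid X] [IsOrderedModule ℝ X] [HasSolidNorm X]
    (hX : IsAMSpace X) (P : X →ₗ[ℝ] X →ₗ[ℝ] X) (hP : IsAMAlgebraProduct.{u, v} P) :
    (∀ Q : X →ₗ[ℝ] X →ₗ[ℝ] X, IsAMAlgebraProduct.{u, w} Q → Q = P) ∧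
    (∀ (x y : X) (φ : KX X), (φ : WeakDual ℝ X) ≠ 0 →
      (ev (P x y) : C(KX X, ℝ)) φ =
        (ev x : C(KX X, ℝ)) φ * (ev y : C(KX X, ℝ)) φ /
          ‖WeakDual.toStrongDual (φ : WeakDual ℝ X)‖) := by
  refine ⟨fun Q hQ => ?_, fun x y φ hφ => ?_⟩
  · have hadd : ∀ φ ψ : StrongDual ℝ X, (∀ x : X, 0 ≤ x → 0 ≤ φ x) →
        (∀ x : X, 0 ≤ x → 0 ≤ ψ x) → ‖φ + ψ‖ = ‖φ‖ + ‖ψ‖ := by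
      obtain ⟨_, ι, _, _, _, e, he, _⟩ := hP
      exact fun φ ψ hφ hψ => he.norm_add hφ hψ
    ext x y
    by_contra hne
    obtain ⟨φ, hφ, hφz⟩ := exists_mem_KX_apply_ne_zero hadd (sub_ne_zero.2 hne)
    have hφ0 : WeakDual.toStrongDual φ ≠ 0 := by
      intro h
      apply hφz
      change WeakDual.toStrongDual φ _ = 0
      rw [h]
      rfl
    apply hφz
    rw [map_sub]
    exact sub_eq_zero.2 ((hQ.apply_eq (φ := WeakDual.toStrongDual φ) hφ.1 hφ0 x y).trans
      (hP.apply_eq (φ := WeakDual.toStrongDual φ) hφ.1 hφ0 x y).symm)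
  · exact hP.apply_eq (φ := WeakDual.toStrongDual (φ : WeakDual ℝ X)) φ.2.1
      (fun h => hφ ((map_eq_zero_iff _ WeakDual.toStrongDual.injective).1 h)) x y
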